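/- **The logic $\mathcal S$.** Formulas are built from countably many variables in the language $\langle\land,\lor,\Rightarrow,\neg,0\rangle$; put $1:=\neg 0$, $\phi\Leftrightarrow\psi:=(\phi\Rightarrow\psi)\land(\psi\Rightarrow\phi)$, $\phi\Rightarrow^2\psi:=\phi\Rightarrow(\phi\Rightarrow\psi)$, and for a finite (possibly empty) list $\Gamma=(\phi_1,\dots,\phi_n)$ put $\Gamma\Rightarrow\phi:=\phi_1\Rightarrow(\cdots(\phi_n\Rightarrow\phi)\cdots)$ and $\Gamma\Rightarrow^2\phi:=\phi_1\Rightarrow^2(\cdots(\phi_n\Rightarrow^2\phi)\cdots)$. $\vdash_{\mathcal S}$ is the consequence relation of the Hilbert-style calculus with axiom schemata $\phi\Rightarrow\phi$; $0\Rightarrow\psi$; $\neg\phi\Rightarrow(\phi\Rightarrow 0)$; $1$; $(\phi\Rightarrow\psi)\Leftrightarrow(\neg\psi\Rightarrow\neg\phi)$ and the rule schemata (premises / conclusion): - $\Gamma\Rightarrow(\phi\Rightarrow(\psi\Rightarrow\gamma))\ /\ \Gamma\Rightarrow(\psi\Rightarrow(\phi\Rightarrow\gamma))$; - $\phi\Rightarrow(\phi\Rightarrow(\phi\Rightarrow\gamma))\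 /\ \phi\Rightarrow(\phi\Rightarrow\gamma)$; - $\Gamma\Rightarrow\phi,\ \phi\Rightarrow\gamma\ /\ \Gamma\Rightarrow\gamma$; - $\Gamma\Rightarrow\phi,\ \psi\Rightarrow\gamma\ /\ \Gamma\Rightarrow((\phi\Rightarrow\psi)\Rightarrow\gamma)$; $\gamma\ /\ \phi\Rightarrow\gamma$; - $\phi\Rightarrow\gamma\ /\ (\phi\land\psi)\Rightarrow\gamma$; $\psi\Rightarrow\gamma\ /\ (\phi\land\psi)\Rightarrow\gamma$; $\Gamma\Rightarrow\phi,\ \Gamma\Rightarrow\psi\ /\ \Gamma\Rightarrow(\phi\land\psi)$; - $\phi\Rightarrow\gamma,\ \psi\Rightarrow\gamma\ /\ (\phi\lor\psi)\Rightarrow\gamma$; $\phi\Rightarrow^2\gamma,\ \psi\Rightarrow^2\gamma\ /\ (\phi\lor\psi)\Rightarrow^2\gamma$; $\Gamma\Rightarrow\phi\ /\ \Gamma\Rightarrow(\phi\lor\psi)$; $\Gamma\Rightarrow\psi\ /\ \Gamma\Rightarrow(\phi\lor\psi)$; - $(\phi\land\neg\psi)\Rightarrow\gamma\ /\ \neg(\phi\Rightarrow\psi)\Rightarrow\gamma$;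 $\Gamma\Rightarrow^2(\phi\land\neg\psi)\ /\ \Gamma\Rightarrow^2\neg(\phi\Rightarrow\psi)$; - $(\neg\phi\lor\neg\psi)\Rightarrow\gamma\ /\ \neg(\phi\land\psi)\Rightarrow\gamma$; $\Gamma\Rightarrow(\neg\phi\lor\neg\psi)\ /\ \Gamma\Rightarrow\neg(\phi\land\psi)$; - $(\neg\phi\land\neg\psi)\Rightarrow\gamma\ /\ \neg(\phi\lor\psi)\Rightarrow\gamma$; $\Gamma\Rightarrow(\neg\phi\land\neg\psi)\ /\ \Gamma\Rightarrow\neg(\phi\lor\psi)$; - $\phi\Rightarrow\gamma\ /\ \neg\neg\phi\Rightarrow\gamma$; $\Gamma\Rightarrow\phi\ /\ \Gamma\Rightarrow\neg\neg\phi$. **The logic $\mathcal N3$.** In the language $\langle\land,\lor,\to,\neg\rangle$, $\vdash_{\mathcal N3}$ is the consequence relation of the calculus whose only rule is modus ponens and whose axiom schemata are $\phi\to(\psi\to\phi)$; $(\phi\to(\psi\to\gamma))\to((\phi\to\psi)\to(\phi\to\gamma))$; $(\phi\land\psi)\to\phi$; $(\phi\land\psi)\to\psi$; $(\phi\to\psi)\to((\phi\to\gamma)\to(\phi\to(\psi\land\gamma)))$;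 $\phi\to(\phi\lor\psi)$; $\psi\to(\phi\lor\psi)$; $(\phi\to\gamma)\to((\psi\to\gamma)\to((\phi\lor\psi)\to\gamma))$; $\neg\neg\phi\leftrightarrow\phi$; $\neg(\phi\lor\psi)\leftrightarrow(\neg\phi\land\neg\psi)$; $\neg(\phi\land\psi)\leftrightarrow(\neg\phi\lor\neg\psi)$; $\neg(\phi\to\psi)\leftrightarrow(\phi\land\neg\psi)$; $\neg\phi\to(\phi\to\psi)$, where $\phi\leftrightarrow\psi:=(\phi\to\psi)\land(\psi\to\phi)$. **Common language.** Both logics are compared over $\langle\land,\lor,\Rightarrow,\neg,0,1\rangle$. In $\mathcal S$, $1$ is read as $\neg 0$. In $\mathcal N3$, $\phi\Rightarrow\psi$ is read as $(\phi\to\psi)\land(\neg\psi\to\neg\phi)$, $1$ as $\alpha\to\alpha$ and $0$ as $\neg(\alpha\to\alpha)$, where $\alpha$ is any fixed formula. **Algebras.** An *$\mathcal S$-algebra* is an algebra $\langle A,\land,\lor,\Rightarrow,\neg,0,1\rangle$ of type $\langle2,2,2,1,0,0\rangle$ such that: every axiom of $\mathcal S$ has the value $1$ under all valuations; $x\Rightarrow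 x=1$ for all $x$; for every instance of a rule of $\mathcal S$ and every valuation, if all premises have the value $1$, then so has the conclusion; and $x\Rightarrow y=1=y\Rightarrow x$ implies $x=y$. (Here the formula $1$ is evaluated as $\neg 0$.) An *$\mathcal N3$-lattice* is an algebra $\langle A,\lor,\land,\to,\neg\rangle$ such that: $\langle A,\lor,\land\rangle$ is a distributive lattice with $\neg\neg a=a$ and $\neg(a\lor b)=\neg a\land\neg b$; the relation $a\preceq b$, defined by $(a\to b)\to(a\to b)=a\to b$, is a pre-order; the relation $a\equiv b$, defined by $a\preceq b\preceq a$, is compatible with $\land,\lor,\to$, and $\langle A,\lor,\land,\to\rangle/{\equiv}$ is an implicative lattice (a lattice with a greatest element in which $x\land y\le z$ iff $x\le y\to z$); $\neg(a\to b)\equiv a\land\neg b$; $a\le b$ iff $a\preceq b$ and $\neg b\preceq\neg a$; and $\neg a\to(a\to b)=a\to a$. **Proposition.** 1. Over the language $\langle\land,\lor,\Rightarrow,\neg,0,1\rangle$, $\mathcal N3$ is a proper strengthening of $\mathcal S$: $T\vdash_{\mathcal S}\phi$ implies $T\vdash_{\mathcal N3}\phi$ for every set $T$ of formulas and every formula $\phi$,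 and there are $T$ and $\phi$ with $T\vdash_{\mathcal N3}\phi$ but $T\nvdash_{\mathcal S}\phi$. 2. If $A$ is an $\mathcal N3$-lattice and $e\in A$, then $\langle A,\land,\lor,\Rightarrow,\neg,0,1\rangle$ with $x\Rightarrow y:=(x\to y)\land(\neg y\to\neg x)$, $1:=e\to e$ and $0:=\neg 1$ is an $\mathcal S$-algebra. 3. There is an $\mathcal S$-algebra in which $x\land(y\lor z)=(x\land y)\lor(x\land z)$ fails for some $x,y,z$. -/

import Mathlib

universe u

namespace Nelson

/-! ### Nelson's logic `S` -/

/-- Formulas in the language `⟨∧, ∨, ⇒, ¬, 0⟩` of the logic `S`. -/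
inductive SForm : Type
  | var : ℕ → SForm
  | and : SForm → SForm → SForm
  | or : SForm → SForm → SForm
  | imp : SForm → SForm → SForm
  | neg : SForm → SForm
  | zero : SForm

namespace SForm

/-- `1 := ¬ 0`. -/
def one : SForm := zero.neg

/-- `φ ⇔ ψ := (φ ⇒ ψ) ∧ (ψ ⇒ φ)`. -/
def iff (φ ψ : SForm) : SForm := (φ.imp ψ).and (ψ.imp φ)

/-- `φ ⇒² ψ := φ ⇒ (φ ⇒ ψ)`. -/
def imp2 (φ ψ : SForm) : SForm := φ.imp (φ.imp ψ)

/-- `Γ ⇒ φ := φ₁ ⇒ (φ₂ ⇒ (… ⇒ (φₙ ⇒ φ)…))`, which is `φ` when `Γ` is empty. -/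
def imps (Γ : List SForm) (φ : SForm) : SForm := Γ.foldr imp φ

/-- `Γ ⇒² φ := φ₁ ⇒² (φ₂ ⇒² (… ⇒² (φₙ ⇒² φ)…))`. -/
def imps2 (Γ : List SForm) (φ : SForm) : SForm := Γ.foldr imp2 φ

end SForm

open SForm in
/-- The axioms of `S`. -/
inductive SAxiom : SForm → Prop
  | a1 (φ : SForm) : SAxiom (φ.imp φ)
  | a2 (ψ : SForm) : SAxiom (zero.imp ψ)
  | a3 (φ : SForm) : SAxiom (φ.neg.imp (φ.imp zero))
  | a4 : SAxiom one
  | a5 (φ ψ : SForm) : SAxiom ((φ.imp ψ).iff (ψ.neg.imp φ.neg))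

open SForm in
/-- The rules of `S`: `SRule Ps φ` says that `φ` follows by one rule from the list `Ps` of
premises. -/
inductive SRule : List SForm → SForm → Prop
  | p (Γ : List SForm) (φ ψ γ : SForm) :
      SRule [imps Γ (φ.imp (ψ.imp γ))] (imps Γ (ψ.imp (φ.imp γ)))
  | c (φ γ : SForm) : SRule [φ.imp (φ.imp (φ.imp γ))] (φ.imp (φ.imp γ))
  | e (Γ : List SForm) (φ γ : SForm) : SRule [imps Γ φ, φ.imp γ] (imps Γ γ)
  | imp_l (Γ : List SForm) (φ ψ γ : SForm) :
      SRule [imps Γ φ, ψ.imp γ] (imps Γ ((φ.imp ψ).imp γ))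
  | imp_r (φ γ : SForm) : SRule [γ] (φ.imp γ)
  | and_l1 (φ ψ γ : SForm) : SRule [φ.imp γ] ((φ.and ψ).imp γ)
  | and_l2 (φ ψ γ : SForm) : SRule [ψ.imp γ] ((φ.and ψ).imp γ)
  | and_r (Γ : List SForm) (φ ψ : SForm) : SRule [imps Γ φ, imps Γ ψ] (imps Γ (φ.and ψ))
  | or_l1 (φ ψ γ : SForm) : SRule [φ.imp γ, ψ.imp γ] ((φ.or ψ).imp γ)
  | or_l2 (φ ψ γ : SForm) : SRule [φ.imp2 γ, ψ.imp2 γ] ((φ.or ψ).imp2 γ)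
  | or_r1 (Γ : List SForm) (φ ψ : SForm) : SRule [imps Γ φ] (imps Γ (φ.or ψ))
  | or_r2 (Γ : List SForm) (φ ψ : SForm) : SRule [imps Γ ψ] (imps Γ (φ.or ψ))
  | neg_imp_l (φ ψ γ : SForm) : SRule [(φ.and ψ.neg).imp γ] ((φ.imp ψ).neg.imp γ)
  | neg_imp_r (Γ : List SForm) (φ ψ : SForm) :
      SRule [imps2 Γ (φ.and ψ.neg)] (imps2 Γ (φ.imp ψ).neg)
  | neg_and_l (φ ψ γ : SForm) : SRule [(φ.neg.or ψ.neg).imp γ] ((φ.and ψ).neg.imp γ)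
  | neg_and_r (Γ : List SForm) (φ ψ : SForm) :
      SRule [imps Γ (φ.neg.or ψ.neg)] (imps Γ (φ.and ψ).neg)
  | neg_or_l (φ ψ γ : SForm) : SRule [(φ.neg.and ψ.neg).imp γ] ((φ.or ψ).neg.imp γ)
  | neg_or_r (Γ : List SForm) (φ ψ : SForm) :
      SRule [imps Γ (φ.neg.and ψ.neg)] (imps Γ (φ.or ψ).neg)
  | neg_neg_l (φ γ : SForm) : SRule [φ.imp γ] (φ.neg.neg.imp γ)
  | neg_neg_r (Γ : List SForm) (φ : SForm) : SRule [imps Γ φ] (imps Γ φ.neg.neg)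

/-- The consequence relation `T ⊢ φ` of `S`. -/
inductive SProves (T : Set SForm) : SForm → Prop
  | hyp {φ : SForm} (h : φ ∈ T) : SProves T φ
  | ax {φ : SForm} (h : SAxiom φ) : SProves T φ
  | rule {Ps : List SForm} {φ : SForm} (h : SRule Ps φ)
      (hPs : ∀ ψ ∈ Ps, SProves T ψ) : SProves T φ

/-! ### Nelson's logic `N3` -/

/-- Formulas in the language `⟨∧, ∨, →, ¬⟩` of the logics `N4` and `N3`, where `→` (here `imp`)
is the weak implication. -/
inductive NForm : Type
  | var : ℕ → NForm
  | and : NForm → NForm → NForm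
  | or : NForm → NForm → NForm
  | imp : NForm → NForm → NForm
  | neg : NForm → NForm

namespace NForm

/-- `φ ↔ ψ := (φ → ψ) ∧ (ψ → φ)`. -/
def iff (φ ψ : NForm) : NForm := (φ.imp ψ).and (ψ.imp φ)

/-- The strong implication `φ ⇒ ψ := (φ → ψ) ∧ (¬ψ → ¬φ)`. -/
def strong (φ ψ : NForm) : NForm := (φ.imp ψ).and (ψ.neg.imp φ.neg)

end NForm

/-- The axioms of `N4`. -/
inductive N4Axiom : NForm → Prop
  | n1 (φ ψ : NForm) : N4Axiom (φ.imp (ψ.imp φ))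
  | n2 (φ ψ γ : NForm) :
      N4Axiom ((φ.imp (ψ.imp γ)).imp ((φ.imp ψ).imp (φ.imp γ)))
  | n3 (φ ψ : NForm) : N4Axiom ((φ.and ψ).imp φ)
  | n4 (φ ψ : NForm) : N4Axiom ((φ.and ψ).imp ψ)
  | n5 (φ ψ γ : NForm) :
      N4Axiom ((φ.imp ψ).imp ((φ.imp γ).imp (φ.imp (ψ.and γ))))
  | n6 (φ ψ : NForm) : N4Axiom (φ.imp (φ.or ψ))
  | n7 (φ ψ : NForm) : N4Axiom (ψ.imp (φ.or ψ))
  | n8 (φ ψ γ : NForm) :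
      N4Axiom ((φ.imp γ).imp ((ψ.imp γ).imp ((φ.or ψ).imp γ)))
  | n9 (φ : NForm) : N4Axiom (φ.neg.neg.iff φ)
  | n10 (φ ψ : NForm) : N4Axiom ((φ.or ψ).neg.iff (φ.neg.and ψ.neg))
  | n11 (φ ψ : NForm) : N4Axiom ((φ.and ψ).neg.iff (φ.neg.or ψ.neg))
  | n12 (φ ψ : NForm) : N4Axiom ((φ.imp ψ).neg.iff (φ.and ψ.neg))

/-- The axioms of `N3`: those of `N4` together with `¬φ → (φ → ψ)`. -/
inductive N3Axiom : NForm → Prop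
  | ofN4 {φ : NForm} (h : N4Axiom φ) : N3Axiom φ
  | n13 (φ ψ : NForm) : N3Axiom (φ.neg.imp (φ.imp ψ))

/-- The consequence relation `T ⊢ φ` of `N3`; the only rule is modus ponens. -/
inductive N3Proves (T : Set NForm) : NForm → Prop
  | hyp {φ : NForm} (h : φ ∈ T) : N3Proves T φ
  | ax {φ : NForm} (h : N3Axiom φ) : N3Proves T φ
  | mp {φ ψ : NForm} (h₁ : N3Proves T φ) (h₂ : N3Proves T (φ.imp ψ)) : N3Proves T ψ

/-! ### The common language -/

/-- Formulas in the common language `⟨∧, ∨, ⇒, ¬, 0, 1⟩`. -/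
inductive CForm : Type
  | var : ℕ → CForm
  | and : CForm → CForm → CForm
  | or : CForm → CForm → CForm
  | imp : CForm → CForm → CForm
  | neg : CForm → CForm
  | zero : CForm
  | one : CForm

/-- Unfolding the connectives of the common language in the language of `S`: `1` is `¬0`. -/
def CForm.toS : CForm → SForm
  | .var n => .var n
  | .and φ ψ => .and φ.toS ψ.toS
  | .or φ ψ => .or φ.toS ψ.toS
  | .imp φ ψ => .imp φ.toS ψ.toS
  | .neg φ => .neg φ.toS
  | .zero => .zero
  | .one => .one

/-- Unfolding the connectives of the common language in the language of `N3`: `⇒` is the strong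
implication, `1` is `α → α` and `0` is `¬1`. -/
def CForm.toN (α : NForm) : CForm → NForm
  | .var n => .var n
  | .and φ ψ => .and (φ.toN α) (ψ.toN α)
  | .or φ ψ => .or (φ.toN α) (ψ.toN α)
  | .imp φ ψ => .strong (φ.toN α) (ψ.toN α)
  | .neg φ => .neg (φ.toN α)
  | .zero => .neg (.imp α α)
  | .one => .imp α α

/-- The consequence relation of `S` over the common language. -/
def SConsequence (T : Set CForm) (φ : CForm) : Prop :=
  SProves (CForm.toS '' T) φ.toS

/-- The consequence relation of `N3` over the common language, with `1 := α → α`. -/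
def N3Consequence (α : NForm) (T : Set CForm) (φ : CForm) : Prop :=
  N3Proves (CForm.toN α '' T) (φ.toN α)

/-- `L'` is a strengthening of `L` (two consequence relations on the same formulas). -/
def IsStrengthening {F : Type*} (L' L : Set F → F → Prop) : Prop :=
  ∀ (T : Set F) (φ : F), L T φ → L' T φ

/-- `L'` is a strengthening of `L` and does not coincide with it. -/
def IsProperStrengthening {F : Type*} (L' L : Set F → F → Prop) : Prop :=
  IsStrengthening L' L ∧ ∃ (T : Set F) (φ : F), L' T φ ∧ ¬ L T φ

/-! ### `S`-algebras -/

/-- Algebras `⟨A, ∧, ∨, ⇒, ¬, 0, 1⟩` of type `⟨2, 2, 2, 1, 0, 0⟩`. -/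
structure SOps (A : Type u) where
  meet : A → A → A
  join : A → A → A
  imp : A → A → A
  neg : A → A
  zero : A
  one : A

/-- The value of a formula under a valuation of the variables. -/
def SOps.eval {A : Type u} (M : SOps A) (v : ℕ → A) : SForm → A
  | .var n => v n
  | .and φ ψ => M.meet (M.eval v φ) (M.eval v ψ)
  | .or φ ψ => M.join (M.eval v φ) (M.eval v ψ)
  | .imp φ ψ => M.imp (M.eval v φ) (M.eval v ψ)
  | .neg φ => M.neg (M.eval v φ)
  | .zero => M.zero

/-- `S`-algebras. -/
structure SOps.IsSAlgebra {A : Type u} (M : SOps A) : Prop where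
  ax : ∀ φ : SForm, SAxiom φ → ∀ v : ℕ → A, M.eval v φ = M.one
  imp_self : ∀ x : A, M.imp x x = M.one
  rule : ∀ (Ps : List SForm) (φ : SForm), SRule Ps φ →
    ∀ v : ℕ → A, (∀ ψ ∈ Ps, M.eval v ψ = M.one) → M.eval v φ = M.one
  antisymm : ∀ x y : A, M.imp x y = M.one → M.imp y x = M.one → x = y

/-- Distributivity of the `⟨∧, ∨⟩`-reduct. -/
def SOps.IsDistributive {A : Type u} (M : SOps A) : Prop :=
  ∀ x y z : A, M.meet x (M.join y z) = M.join (M.meet x y) (M.meet x z)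

/-! ### `N4`-lattices and `N3`-lattices -/

/-- De Morgan lattices (not necessarily bounded). -/
class DeMorganLattice (A : Type u) extends DistribLattice A where
  neg : A → A
  neg_neg : ∀ a : A, neg (neg a) = a
  neg_sup : ∀ a b : A, neg (a ⊔ b) = neg a ⊓ neg b

/-- De Morgan lattices with a further binary operation `→`. -/
class DeMorganImpLattice (A : Type u) extends DeMorganLattice A where
  imp : A → A → A

section

variable {A : Type u} [DeMorganImpLattice A]

open DeMorganLattice DeMorganImpLattice

/-- `a ≼ b` iff `(a → b) → (a → b) = a → b`. -/
def Pre (a b : A) : Prop := imp (imp a b) (imp a b) = imp a b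

/-- `a ≡ b` iff `a ≼ b` and `b ≼ a`. -/
def Equ (a b : A) : Prop := Pre a b ∧ Pre b a

/-- The relation `≡` as a setoid, given that `≼` is a pre-order. -/
def equSetoid (hr : ∀ a : A, Pre a a) (ht : ∀ a b c : A, Pre a b → Pre b c → Pre a c) :
    Setoid A where
  r := Equ
  iseqv :=
    { refl := fun a => ⟨hr a, hr a⟩
      symm := fun h => ⟨h.2, h.1⟩
      trans := fun h k => ⟨ht _ _ _ h.1 k.1, ht _ _ _ k.2 h.2⟩ }

end

open DeMorganLattice DeMorganImpLattice in
/-- `N4`-lattices. Implicative lattices are Mathlib's generalized Heyting algebras: `quotient` says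
that the quotient of `⟨A, ∨, ∧, →⟩` by `≡` is one, with the operations induced from `A`. -/
class N4Lattice (A : Type u) extends DeMorganImpLattice A where
  pre_refl : ∀ a : A, Pre a a
  pre_trans : ∀ a b c : A, Pre a b → Pre b c → Pre a c
  equ_inf : ∀ a a' b b' : A, Equ a a' → Equ b b' → Equ (a ⊓ b) (a' ⊓ b')
  equ_sup : ∀ a a' b b' : A, Equ a a' → Equ b b' → Equ (a ⊔ b) (a' ⊔ b')
  equ_imp : ∀ a a' b b' : A, Equ a a' → Equ b b' → Equ (imp a b) (imp a' b')
  quotient : ∃ _ : GeneralizedHeytingAlgebra (Quotient (equSetoid pre_refl pre_trans)),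
    ∀ a b : A,
      (Quotient.mk (equSetoid pre_refl pre_trans) a ⊓
          Quotient.mk (equSetoid pre_refl pre_trans) b =
        Quotient.mk (equSetoid pre_refl pre_trans) (a ⊓ b)) ∧
      (Quotient.mk (equSetoid pre_refl pre_trans) a ⊔
          Quotient.mk (equSetoid pre_refl pre_trans) b =
        Quotient.mk (equSetoid pre_refl pre_trans) (a ⊔ b)) ∧
      (Quotient.mk (equSetoid pre_refl pre_trans) a ⇨
          Quotient.mk (equSetoid pre_refl pre_trans) b =
        Quotient.mk (equSetoid pre_refl pre_trans) (imp a b))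
  neg_imp : ∀ a b : A, Equ (neg (imp a b)) (a ⊓ neg b)
  le_iff : ∀ a b : A, a ≤ b ↔ Pre a b ∧ Pre (neg b) (neg a)

open DeMorganLattice DeMorganImpLattice in
/-- `N3`-lattices: `N4`-lattices that satisfy `¬x → (x → y) = x → x`. -/
class N3Lattice (A : Type u) extends N4Lattice A where
  explosion : ∀ x y : A, imp (neg x) (imp x y) = imp x x

open DeMorganLattice DeMorganImpLattice in
/-- The `⟨∧, ∨, ⇒, ¬, 0, 1⟩`-reduct of an `N3`-lattice, where
`x ⇒ y := (x → y) ∧ (¬y → ¬x)`, `1 := e → e` and `0 := ¬1`. -/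
def N3Lattice.reduct (A : Type u) [N3Lattice A] (e : A) : SOps A where
  meet := fun x y => x ⊓ y
  join := fun x y => x ⊔ y
  imp := fun x y => imp x y ⊓ imp (neg y) (neg x)
  neg := neg
  zero := neg (imp e e)
  one := imp e e

end Nelson

/-! All three claims rest on one class of models: involutive integral residuated lattices with
fusion `x * y := ¬(x ⇒ ¬y)` satisfying `x * x * x = x * x`. Every such lattice is an `S`-algebra
(`eval_rule`). A prefix `Γ ⇒` acts as `p ⇒` for a single element `p`, so each rule becomes an
inequality; only the two rules with `⇒²` on compound premises need real work.

Twist structures supply the models for `N3`. An element is a pair (evidence for, evidence against)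
of disjoint elements of a generalized Heyting algebra, and strong implication makes these pairs a
lattice of the class above (`SOps.IsTwist.isPotentResiduated`). An `N3`-lattice embeds by `a ↦ ([a],
[¬a])`, which gives claim 2. For the logic, the twist structure over the Lindenbaum algebra of `T`
has a valuation sending `φ` to `([φ], [¬φ])`. Its value is `1` exactly when `T` proves `φ` in `N3`,
so soundness of `S` yields the strengthening without translating derivations. The second coordinate
is needed because interderivable formulas may have inequivalent negations.

Twist structures are distributive, so `N3` proves the distributive law. A non-distributive model
with 12 elements refutes it in `S`, which gives both properness and claim 3. -/

namespace Nelson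

/-! ### Three-potent involutive residuated lattices are `S`-algebras -/

/-- Three-potent involutive integral residuated lattices, presented by implication and negation;
the order is given by `x ⇒ y = 1`. -/
structure SOps.IsPotentResiduated {A : Type u} (M : SOps A) : Prop where
  refl : ∀ x, M.imp x x = M.one
  antisymm : ∀ x y, M.imp x y = M.one → M.imp y x = M.one → x = y
  trans : ∀ x y z, M.imp x y = M.one → M.imp y z = M.one → M.imp x z = M.one
  meet_left : ∀ x y, M.imp (M.meet x y) x = M.one
  meet_right : ∀ x y, M.imp (M.meet x y) y = M.one
  le_meet : ∀ x y z, M.imp x y = M.one → M.imp x z = M.one → M.imp x (M.meet y z) = M.one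
  join_left : ∀ x y, M.imp x (M.join x y) = M.one
  join_right : ∀ x y, M.imp y (M.join x y) = M.one
  join_le : ∀ x y z, M.imp x z = M.one → M.imp y z = M.one → M.imp (M.join x y) z = M.one
  zero_le : ∀ x, M.imp M.zero x = M.one
  neg_zero : M.neg M.zero = M.one
  neg_neg : ∀ x, M.neg (M.neg x) = x
  contrapose : ∀ x y, M.imp (M.neg y) (M.neg x) = M.imp x y
  exchange : ∀ x y z, M.imp x (M.imp y z) = M.imp y (M.imp x z)
  potent : ∀ x y, M.imp x (M.imp x (M.imp x y)) = M.imp x (M.imp x y)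

namespace SOps.IsPotentResiduated

variable {A : Type u} {M : SOps A} (h : M.IsPotentResiduated)
include h

theorem le_one (x : A) : M.imp x M.one = M.one := by
  rw [← h.neg_zero, ← h.neg_neg x, h.contrapose, h.zero_le, h.neg_zero]

theorem eq_one {x : A} (hx : M.imp M.one x = M.one) : x = M.one :=
  h.antisymm _ _ (h.le_one x) hx

theorem one_imp (x : A) : M.imp M.one x = x := by
  apply h.antisymm
  · apply h.eq_one
    rw [h.exchange, h.refl]
  · rw [h.exchange, h.refl, h.refl]

theorem imp_zero (x : A) : M.imp x M.zero = M.neg x := by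
  rw [← h.contrapose, h.neg_zero, h.one_imp]

/-- Currying for the fusion `x * y := ¬ (x ⇒ ¬ y)`. -/
theorem curry (x y z : A) :
    M.imp x (M.imp y z) = M.imp (M.neg (M.imp x (M.neg y))) z := by
  rw [← h.contrapose y z, h.exchange, ← h.contrapose _ z, h.neg_neg]

theorem exch {x y z : A} (hx : M.imp x (M.imp y z) = M.one) :
    M.imp y (M.imp x z) = M.one := by
  rw [h.exchange, hx]

theorem imp_mono (x : A) {y z : A} (hyz : M.imp y z = M.one) :
    M.imp (M.imp x y) (M.imp x z) = M.one := by
  rw [h.curry]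
  refine h.trans _ y _ ?_ hyz
  rw [← h.curry, h.refl]

theorem imp_anti {x y : A} (z : A) (hxy : M.imp x y = M.one) :
    M.imp (M.imp y z) (M.imp x z) = M.one :=
  h.exch (h.trans _ _ _ hxy (h.exch (h.refl _)))

theorem le_neg {x y : A} (hxy : M.imp y (M.neg x) = M.one) : M.imp x (M.neg y) = M.one := by
  rw [← h.contrapose, h.neg_neg, hxy]

theorem neg_le {x y : A} (hxy : M.imp (M.neg x) y = M.one) : M.imp (M.neg y) x = M.one := by
  rw [← h.contrapose, h.neg_neg, hxy]

theorem neg_anti {x y : A} (hxy : M.imp x y = M.one) : M.imp (M.neg y) (M.neg x) = M.one := by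
  rw [h.contrapose, hxy]

theorem neg_meet (x y : A) : M.neg (M.meet x y) = M.join (M.neg x) (M.neg y) := by
  apply h.antisymm
  · apply h.neg_le
    exact h.le_meet _ _ _ (h.neg_le (h.join_left _ _)) (h.neg_le (h.join_right _ _))
  · exact h.join_le _ _ _ (h.neg_anti (h.meet_left _ _)) (h.neg_anti (h.meet_right _ _))

theorem neg_join (x y : A) : M.neg (M.join x y) = M.meet (M.neg x) (M.neg y) := by
  rw [← h.neg_neg (M.meet _ _), h.neg_meet, h.neg_neg, h.neg_neg]

/-- `¬(x ⇒ y)` is the fusion `x * ¬y`, which by integrality lies below both factors. -/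
theorem neg_imp_le (x y : A) :
    M.imp (M.neg (M.imp x y)) (M.meet x (M.neg y)) = M.one := by
  apply h.le_meet
  · apply h.neg_le
    rw [← h.imp_zero]
    exact h.imp_mono _ (h.zero_le _)
  · apply h.neg_anti
    rw [h.exchange, h.refl, h.le_one]

/-- The hypothesis `hp` says that `p` is idempotent for fusion, so `p = p * p ≤ x * ¬y`. This is why
the corresponding rule carries `Γ ⇒²`. -/
theorem le_neg_imp {p x y : A} (hp : ∀ y, M.imp p (M.imp p y) = M.imp p y)
    (hxy : M.imp p (M.meet x (M.neg y)) = M.one) : M.imp p (M.neg (M.imp x y)) = M.one := by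
  have hx := h.trans _ _ _ hxy (h.meet_left _ _)
  have hy := h.le_neg (h.trans _ _ _ hxy (h.meet_right _ _))
  apply h.le_neg
  -- The chain is `x ⇒ y ≤ p ⇒ y ≤ p ⇒ ¬p`, and `p ⇒ ¬p = p ⇒ (p ⇒ 0)` collapses to `¬p` by `hp`.
  have := h.trans _ _ _ (h.imp_anti y hx) (h.imp_mono p hy)
  rwa [← h.imp_zero, hp, h.imp_zero] at this

/-- Pigeonhole: the cube of `x ∨ y` expands into products of three factors from `x`, `y`, each
containing `x * x` or `y * y` and hence below `z`. Three-potency replaces the square by the cube. -/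
theorem join_imp2 {x y z : A} (hx : M.imp x (M.imp x z) = M.one)
    (hy : M.imp y (M.imp y z) = M.one) :
    M.imp (M.join x y) (M.imp (M.join x y) z) = M.one := by
  have hw : ∀ {c}, M.imp c (M.imp c z) = M.one →
      M.imp c (M.imp c (M.imp (M.join x y) z)) = M.one := fun {c} hc => by
    rw [h.exchange c _ z, h.exchange c, hc, h.le_one]
  -- The mixed term `x * y * (x ∨ y)`: whichever factor the join contributes, one of `x`, `y` is
  -- repeated.
  have hxy : M.imp x (M.imp y (M.imp (M.join x y) z)) = M.one := by
    rw [h.exchange y, h.exchange x]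
    apply h.join_le
    · rw [h.exchange x y, h.exchange x y, hx, h.le_one]
    · rw [h.exchange y, hy, h.le_one]
  rw [← h.potent]
  apply h.join_le
  · exact h.exch (h.join_le _ _ _ (hw hx) (h.exch hxy))
  · exact h.exch (h.join_le _ _ _ hxy (hw hy))

/-- By currying, `p` is the fusion of the values of `Γ`, with the unit for the empty list. -/
theorem exists_imps (v : ℕ → A) (Γ : List SForm) :
    ∃ p, ∀ φ, M.eval v (SForm.imps Γ φ) = M.imp p (M.eval v φ) := by
  induction Γ with
  | nil => exact ⟨M.one, fun φ => (h.one_imp _).symm⟩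
  | cons ψ Γ ih =>
    obtain ⟨p, hp⟩ := ih
    refine ⟨M.neg (M.imp (M.eval v ψ) (M.neg p)), fun φ => ?_⟩
    rw [← h.curry, ← hp]
    rfl

/-- Here `p` is the fusion of the squares of the values of `Γ`. It is idempotent because fusion
commutes and three-potency makes each square idempotent. -/
theorem exists_imps2 (v : ℕ → A) (Γ : List SForm) :
    ∃ p, (∀ y, M.imp p (M.imp p y) = M.imp p y) ∧
      ∀ φ, M.eval v (SForm.imps2 Γ φ) = M.imp p (M.eval v φ) := by
  induction Γ with
  | nil => exact ⟨M.one, fun y => h.one_imp _, fun φ => (h.one_imp _).symm⟩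
  | cons ψ Γ ih =>
    obtain ⟨p, hp, hφ⟩ := ih
    set x := M.eval v ψ
    have key : ∀ y, M.imp (M.neg (M.imp x (M.neg (M.neg (M.imp x (M.neg p)))))) y =
        M.imp x (M.imp x (M.imp p y)) := fun y => by rw [← h.curry, ← h.curry]
    refine ⟨M.neg (M.imp x (M.neg (M.neg (M.imp x (M.neg p))))), fun y => ?_, fun φ => ?_⟩
    · rw [key, key, h.exchange p, h.exchange p, hp, h.potent, h.potent]
    · rw [key, ← hφ]
      rfl

theorem eval_ax {φ : SForm} (hφ : SAxiom φ) (v : ℕ → A) : M.eval v φ = M.one := by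
  cases hφ with
  | a1 φ => exact h.refl _
  | a2 ψ => exact h.zero_le _
  | a3 φ =>
    change M.imp _ (M.imp _ M.zero) = _
    rw [h.imp_zero]
    exact h.refl _
  | a4 => exact h.neg_zero
  | a5 φ ψ =>
    change M.meet (M.imp (M.imp _ _) (M.imp (M.neg _) (M.neg _)))
      (M.imp (M.imp (M.neg _) (M.neg _)) (M.imp _ _)) = _
    rw [h.contrapose, h.refl]
    exact h.eq_one (h.le_meet _ _ _ (h.refl _) (h.refl _))

theorem eval_rule {Ps : List SForm} {φ : SForm} (hr : SRule Ps φ) (v : ℕ → A)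
    (hPs : ∀ ψ ∈ Ps, M.eval v ψ = M.one) : M.eval v φ = M.one := by
  -- With `Γ ⇒` read as `p ⇒`, enlarging the conclusion is just transitivity of the order.
  have weaken : ∀ (Γ : List SForm) (φ ψ : SForm),
      M.imp (M.eval v φ) (M.eval v ψ) = M.one → M.eval v (SForm.imps Γ φ) = M.one →
      M.eval v (SForm.imps Γ ψ) = M.one := by
    intro Γ φ ψ hle hφ
    obtain ⟨p, hp⟩ := h.exists_imps v Γ
    rw [hp] at hφ ⊢
    exact h.trans _ _ _ hφ hle
  cases hr <;> simp only [List.forall_mem_cons, List.not_mem_nil, false_imp_iff,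
    implies_true, and_true] at hPs
  case p Γ φ ψ γ =>
    refine weaken Γ _ _ ?_ hPs
    change M.imp (M.imp _ (M.imp _ _)) (M.imp _ (M.imp _ _)) = _
    rw [h.exchange (M.eval v φ), h.refl]
  case c φ γ => exact (h.potent _ _).symm.trans hPs
  case e Γ φ γ => exact weaken Γ _ _ hPs.2 hPs.1
  case imp_l Γ φ ψ γ =>
    exact weaken Γ _ _ (h.trans _ _ _ (h.exch (h.refl _)) (h.imp_mono _ hPs.2)) hPs.1
  case imp_r φ γ =>
    change M.imp _ _ = _
    rw [hPs, h.le_one]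
  case and_l1 φ ψ γ => exact h.trans _ _ _ (h.meet_left _ _) hPs
  case and_l2 φ ψ γ => exact h.trans _ _ _ (h.meet_right _ _) hPs
  case and_r Γ φ ψ =>
    obtain ⟨p, hp⟩ := h.exists_imps v Γ
    rw [hp, hp] at hPs
    rw [hp]
    exact h.le_meet _ _ _ hPs.1 hPs.2
  case or_l1 φ ψ γ => exact h.join_le _ _ _ hPs.1 hPs.2
  case or_l2 φ ψ γ => exact h.join_imp2 hPs.1 hPs.2
  case or_r1 Γ φ ψ => exact weaken Γ _ _ (h.join_left _ _) hPs
  case or_r2 Γ φ ψ => exact weaken Γ _ _ (h.join_right _ _) hPs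
  case neg_imp_l φ ψ γ => exact h.trans _ _ _ (h.neg_imp_le _ _) hPs
  case neg_imp_r Γ φ ψ =>
    obtain ⟨p, hp, hΓ⟩ := h.exists_imps2 v Γ
    rw [hΓ] at hPs ⊢
    exact h.le_neg_imp hp hPs
  case neg_and_l φ ψ γ => exact (congrArg (M.imp · _) (h.neg_meet _ _)).trans hPs
  case neg_and_r Γ φ ψ =>
    refine weaken Γ _ _ ?_ hPs
    exact (congrArg (M.imp _) (h.neg_meet _ _)).trans (h.refl _)
  case neg_or_l φ ψ γ => exact (congrArg (M.imp · _) (h.neg_join _ _)).trans hPs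
  case neg_or_r Γ φ ψ =>
    refine weaken Γ _ _ ?_ hPs
    exact (congrArg (M.imp _) (h.neg_join _ _)).trans (h.refl _)
  case neg_neg_l φ γ => exact (congrArg (M.imp · _) (h.neg_neg _)).trans hPs
  case neg_neg_r Γ φ =>
    refine weaken Γ _ _ ?_ hPs
    exact (congrArg (M.imp _) (h.neg_neg _)).trans (h.refl _)

theorem isSAlgebra : M.IsSAlgebra where
  ax _ hφ v := h.eval_ax hφ v
  imp_self := h.refl
  rule _ _ hr v hPs := h.eval_rule hr v hPs
  antisymm := h.antisymm

end SOps.IsPotentResiduated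

theorem SProves.eval_eq_one {A : Type u} {M : SOps A} (h : M.IsSAlgebra) {T : Set SForm}
    {φ : SForm} (hφ : SProves T φ) (v : ℕ → A) (hT : ∀ ψ ∈ T, M.eval v ψ = M.one) :
    M.eval v φ = M.one := by
  induction hφ with
  | hyp hmem => exact hT _ hmem
  | ax hax => exact h.ax _ hax v
  | rule hr _ ih => exact h.rule _ _ hr v ih

/-! ### Twist representations -/

/-- `x ↦ (P x, N x)` embeds `M` into the twist structure over a generalized Heyting algebra. -/
structure SOps.IsTwist {A : Type u} (M : SOps A) {H : Type*} [GeneralizedHeytingAlgebra H]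
    (P N : A → H) : Prop where
  inj : ∀ x y, P x = P y → N x = N y → x = y
  disj : ∀ x c, P x ⊓ N x ≤ c
  P_meet : ∀ x y, P (M.meet x y) = P x ⊓ P y
  N_meet : ∀ x y, N (M.meet x y) = N x ⊔ N y
  P_join : ∀ x y, P (M.join x y) = P x ⊔ P y
  N_join : ∀ x y, N (M.join x y) = N x ⊓ N y
  P_imp : ∀ x y, P (M.imp x y) = (P x ⇨ P y) ⊓ (N y ⇨ N x)
  N_imp : ∀ x y, N (M.imp x y) = P x ⊓ N y
  P_neg : ∀ x, P (M.neg x) = N x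
  N_neg : ∀ x, N (M.neg x) = P x
  P_one : P M.one = ⊤
  N_zero : N M.zero = ⊤

namespace SOps.IsTwist

variable {A : Type u} {M : SOps A} {H : Type*} [GeneralizedHeytingAlgebra H] {P N : A → H}
  (h : M.IsTwist P N)
include h

/-- Disjointness forces the coordinate opposite to `⊤` to be least, so `H` need not come with a
bottom. -/
theorem N_one_le (c : H) : N M.one ≤ c := by
  simpa [h.P_one] using h.disj M.one c

theorem P_zero_le (c : H) : P M.zero ≤ c := by
  simpa [h.N_zero] using h.disj M.zero c

theorem eq_one_iff (x : A) : x = M.one ↔ P x = ⊤ := by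
  refine ⟨fun hx => hx ▸ h.P_one, fun hx => h.inj _ _ (hx.trans h.P_one.symm) ?_⟩
  exact le_antisymm (by simpa [hx] using h.disj x (N M.one)) (h.N_one_le _)

theorem le_iff (x y : A) : M.imp x y = M.one ↔ P x ≤ P y ∧ N y ≤ N x := by
  rw [h.eq_one_iff, h.P_imp, inf_eq_top_iff, himp_eq_top_iff, himp_eq_top_iff]

theorem isPotentResiduated : M.IsPotentResiduated where
  refl x := by simp [h.le_iff]
  antisymm x y := by
    simp only [h.le_iff]
    exact fun h1 h2 => h.inj _ _ (le_antisymm h1.1 h2.1) (le_antisymm h2.2 h1.2)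
  trans x y z := by
    simp only [h.le_iff]
    exact fun h1 h2 => ⟨h1.1.trans h2.1, h2.2.trans h1.2⟩
  meet_left x y := by simp [h.le_iff, h.P_meet, h.N_meet]
  meet_right x y := by simp [h.le_iff, h.P_meet, h.N_meet]
  le_meet x y z := by
    simp only [h.le_iff, h.P_meet, h.N_meet, le_inf_iff, sup_le_iff]
    tauto
  join_left x y := by simp [h.le_iff, h.P_join, h.N_join]
  join_right x y := by simp [h.le_iff, h.P_join, h.N_join]
  join_le x y z := by
    simp only [h.le_iff, h.P_join, h.N_join, le_inf_iff, sup_le_iff]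
    tauto
  zero_le x := by simp [h.le_iff, h.P_zero_le, h.N_zero]
  neg_zero := by rw [h.eq_one_iff, h.P_neg, h.N_zero]
  neg_neg x := h.inj _ _ (by rw [h.P_neg, h.N_neg]) (by rw [h.N_neg, h.P_neg])
  contrapose x y := by
    apply h.inj
    · rw [h.P_imp, h.P_imp, h.P_neg, h.P_neg, h.N_neg, h.N_neg, inf_comm]
    · rw [h.N_imp, h.N_imp, h.P_neg, h.N_neg, inf_comm]
  exchange x y z := by
    apply h.inj
    · simp only [h.P_imp, h.N_imp]
      -- Tested against `c`, both sides say `c ⊓ P x ⊓ P y ≤ P z`, `c ⊓ P x ⊓ N z ≤ N y` and `c ⊓ P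
      -- y ⊓ N z ≤ N x`.
      refine eq_of_forall_le_iff fun c => ?_
      simp only [le_inf_iff, le_himp_iff, ← inf_assoc]
      rw [inf_right_comm c (P x) (P y), inf_right_comm c (P x) (N z),
        inf_right_comm c (P y) (N z)]
      tauto
    · simp only [h.N_imp, inf_left_comm]
  potent x y := by
    apply h.inj
    · simp only [h.P_imp, h.N_imp]
      -- Both sides reduce to `c ⊓ P x ≤ P y` and `c ⊓ P x ⊓ N y ≤ N x`. A single `x ⇒ y` would ask
      -- for `c ⊓ N y ≤ N x` without `P x`, so two-potency is not available.
      refine eq_of_forall_le_iff fun c => ?_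
      simp only [le_inf_iff, le_himp_iff, ← inf_assoc]
      simp only [inf_assoc, inf_idem]
      tauto
    · simp only [h.N_imp, ← inf_assoc, inf_idem]

end SOps.IsTwist

/-- The twist structure over a generalized Heyting algebra: pairs of elements whose meet is
least. -/
def Twist (H : Type u) [GeneralizedHeytingAlgebra H] : Type u :=
  {p : H × H // ∀ c, p.1 ⊓ p.2 ≤ c}

namespace Twist

variable {H : Type u} [GeneralizedHeytingAlgebra H]

/-- The operations of the twist structure, with a least element `b` of `H` as first coordinate
of `0`. -/
def ops (b : H) (hb : ∀ c, b ≤ c) : SOps (Twist H) where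
  meet x y := ⟨(x.1.1 ⊓ y.1.1, x.1.2 ⊔ y.1.2), fun c => by
    rw [inf_sup_left]
    exact sup_le ((inf_le_inf_right _ inf_le_left).trans (x.2 c))
      ((inf_le_inf_right _ inf_le_right).trans (y.2 c))⟩
  join x y := ⟨(x.1.1 ⊔ y.1.1, x.1.2 ⊓ y.1.2), fun c => by
    rw [inf_sup_right]
    exact sup_le ((inf_le_inf_left _ inf_le_left).trans (x.2 c))
      ((inf_le_inf_left _ inf_le_right).trans (y.2 c))⟩
  imp x y := ⟨((x.1.1 ⇨ y.1.1) ⊓ (y.1.2 ⇨ x.1.2), x.1.1 ⊓ y.1.2), fun c => by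
    refine le_trans (le_inf ?_ (inf_le_right.trans inf_le_right)) (y.2 c)
    exact (inf_le_inf inf_le_left inf_le_left).trans himp_inf_le⟩
  neg x := ⟨(x.1.2, x.1.1), fun c => by rw [inf_comm]; exact x.2 c⟩
  zero := ⟨(b, ⊤), fun c => inf_le_left.trans (hb c)⟩
  one := ⟨(⊤, b), fun c => inf_le_right.trans (hb c)⟩

theorem isTwist (b : H) (hb : ∀ c, b ≤ c) :
    (ops b hb).IsTwist (fun x => x.1.1) (fun x => x.1.2) where
  inj _ _ h1 h2 := Subtype.ext (Prod.ext h1 h2)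
  disj x := x.2
  P_meet _ _ := rfl
  N_meet _ _ := rfl
  P_join _ _ := rfl
  N_join _ _ := rfl
  P_imp _ _ := rfl
  N_imp _ _ := rfl
  P_neg _ := rfl
  N_neg _ := rfl
  P_one := rfl
  N_zero := rfl

end Twist

/-! ### `N3`-lattices -/

section

open DeMorganLattice DeMorganImpLattice

theorem DeMorganLattice.neg_inf {A : Type u} [DeMorganLattice A] (a b : A) :
    neg (a ⊓ b) = neg a ⊔ neg b := by
  rw [← neg_neg (neg a ⊔ neg b), neg_sup, neg_neg, neg_neg]

/-- A surjective homomorphism `P` with kernel `≡` onto a generalized Heyting algebra yields a twist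
representation of the reduct of an `N3`-lattice. -/
theorem N3Lattice.reduct_isTwist {A : Type u} [N3Lattice A] (e : A) {H : Type*}
    [GeneralizedHeytingAlgebra H] (P : A → H) (surj : Function.Surjective P)
    (P_eq : ∀ {a b}, P a = P b ↔ Equ a b) (P_inf : ∀ a b, P (a ⊓ b) = P a ⊓ P b)
    (P_sup : ∀ a b, P (a ⊔ b) = P a ⊔ P b) (P_imp : ∀ a b, P (imp a b) = P a ⇨ P b) :
    (N3Lattice.reduct A e).IsTwist P (fun a => P (neg a)) := by
  have P_neg_imp (a b : A) : P (neg (imp a b)) = P a ⊓ P (neg b) := by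
    rw [← P_inf, P_eq]
    exact N4Lattice.neg_imp a b
  exact
    { inj := fun a b h1 h2 => by
        rw [P_eq] at h1 h2
        exact le_antisymm ((N4Lattice.le_iff a b).2 ⟨h1.1, h2.2⟩)
          ((N4Lattice.le_iff b a).2 ⟨h1.2, h2.1⟩)
      disj := fun x c => by
        -- Explosion only speaks of elements of `A`; surjectivity of `P` carries it to all of `H`.
        obtain ⟨c, rfl⟩ := surj c
        have := congrArg P (N3Lattice.explosion x c)
        rwa [P_imp, P_imp, P_imp, himp_self, himp_eq_top_iff, le_himp_iff, inf_comm] at this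
      P_meet := P_inf
      N_meet := fun x y => by
        change P (neg (x ⊓ y)) = _
        rw [DeMorganLattice.neg_inf, P_sup]
      P_join := P_sup
      N_join := fun x y => by
        change P (neg (x ⊔ y)) = _
        rw [DeMorganLattice.neg_sup, P_inf]
      P_imp := fun x y => by
        change P (imp x y ⊓ imp (neg y) (neg x)) = _
        rw [P_inf, P_imp, P_imp]
      N_imp := fun x y => by
        change P (neg (imp x y ⊓ imp (neg y) (neg x))) = _
        rw [DeMorganLattice.neg_inf, P_sup, P_neg_imp, P_neg_imp, DeMorganLattice.neg_neg,
          inf_comm (P (neg y)), sup_idem]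
      P_neg := fun _ => rfl
      N_neg := fun x => congrArg P (DeMorganLattice.neg_neg x)
      P_one := (P_imp e e).trans himp_self
      N_zero := (congrArg P (DeMorganLattice.neg_neg (imp e e))).trans
        ((P_imp e e).trans himp_self) }

theorem N3Lattice.reduct_isSAlgebra (A : Type u) [N3Lattice A] (e : A) :
    (N3Lattice.reduct A e).IsSAlgebra := by
  obtain ⟨_, hG⟩ := N4Lattice.quotient (A := A)
  exact (N3Lattice.reduct_isTwist e (Quotient.mk _) Quotient.mk_surjective
    ⟨fun h => Quotient.exact h, fun h => Quotient.sound h⟩ (fun a b => (hG a b).1.symm)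
    (fun a b => (hG a b).2.1.symm)
    (fun a b => (hG a b).2.2.symm)).isPotentResiduated.isSAlgebra

end

/-! ### The Lindenbaum algebra of `N3` -/

namespace N3Proves

variable {T : Set NForm} {φ ψ γ δ : NForm}

theorem axN4 (h : N4Axiom φ) : N3Proves T φ := .ax (.ofN4 h)

theorem const (φ : NForm) (h : N3Proves T ψ) : N3Proves T (φ.imp ψ) :=
  .mp h (axN4 (.n1 ψ φ))

theorem app (h : N3Proves T (φ.imp (ψ.imp γ))) (h' : N3Proves T (φ.imp ψ)) :
    N3Proves T (φ.imp γ) :=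
  .mp h' (.mp h (axN4 (.n2 φ ψ γ)))

theorem refl (φ : NForm) : N3Proves T (φ.imp φ) :=
  app (axN4 (.n1 φ (φ.imp φ))) (axN4 (.n1 φ φ))

theorem trans (h : N3Proves T (φ.imp ψ)) (h' : N3Proves T (ψ.imp γ)) : N3Proves T (φ.imp γ) :=
  app (const φ h') h

theorem le_and (h : N3Proves T (φ.imp ψ)) (h' : N3Proves T (φ.imp γ)) :
    N3Proves T (φ.imp (ψ.and γ)) :=
  .mp h' (.mp h (axN4 (.n5 φ ψ γ)))

theorem or_le (h : N3Proves T (φ.imp γ)) (h' : N3Proves T (ψ.imp γ)) :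
    N3Proves T ((φ.or ψ).imp γ) :=
  .mp h' (.mp h (axN4 (.n8 φ ψ γ)))

theorem and_left (φ ψ : NForm) : N3Proves T ((φ.and ψ).imp φ) := axN4 (.n3 φ ψ)

theorem and_right (φ ψ : NForm) : N3Proves T ((φ.and ψ).imp ψ) := axN4 (.n4 φ ψ)

theorem uncurry (h : N3Proves T (φ.imp (ψ.imp γ))) : N3Proves T ((φ.and ψ).imp γ) :=
  app (trans (and_left φ ψ) h) (and_right φ ψ)

theorem curry (h : N3Proves T ((φ.and ψ).imp γ)) : N3Proves T (φ.imp (ψ.imp γ)) := by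
  have h1 : N3Proves T (φ.imp (ψ.imp (φ.and ψ))) :=
    app (trans (axN4 (.n1 φ ψ)) (axN4 (.n5 ψ φ ψ))) (const φ (refl ψ))
  exact trans h1 (.mp (const ψ h) (axN4 (.n2 ψ _ γ)))

theorem imp_mono (h : N3Proves T (ψ.imp φ)) (h' : N3Proves T (γ.imp δ)) :
    N3Proves T ((φ.imp γ).imp (ψ.imp δ)) :=
  curry (trans (app (and_left _ _) (trans (and_right _ _) h)) h')

end N3Proves

/-- Interderivability in `N3` under the hypotheses `T`. -/
def interSetoid (T : Set NForm) : Setoid NForm where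
  r φ ψ := N3Proves T (φ.imp ψ) ∧ N3Proves T (ψ.imp φ)
  iseqv :=
    { refl := fun φ => ⟨.refl φ, .refl φ⟩
      symm := fun h => ⟨h.2, h.1⟩
      trans := fun h k => ⟨h.1.trans k.1, k.2.trans h.2⟩ }

/-- The Lindenbaum algebra of the weak implication fragment of `N3` under the hypotheses `T`. -/
def Lindenbaum (T : Set NForm) : Type := Quotient (interSetoid T)

namespace Lindenbaum

variable {T : Set NForm}

/-- The class of a formula. -/
def mk (T : Set NForm) (φ : NForm) : Lindenbaum T := Quotient.mk (interSetoid T) φ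

instance : GeneralizedHeytingAlgebra (Lindenbaum T) where
  le := Quotient.lift₂ (fun φ ψ => N3Proves T (φ.imp ψ)) fun _ _ _ _ h k =>
    propext ⟨fun p => (h.2.trans p).trans k.1, fun p => (h.1.trans p).trans k.2⟩
  le_refl := by
    rintro ⟨φ⟩
    exact .refl φ
  le_trans := by
    rintro ⟨φ⟩ ⟨ψ⟩ ⟨γ⟩ h k
    exact N3Proves.trans h k
  le_antisymm := by
    rintro ⟨φ⟩ ⟨ψ⟩ h k
    exact Quotient.sound ⟨h, k⟩
  sup := Quotient.map₂ NForm.or fun _ _ h _ _ k =>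
    ⟨.or_le (h.1.trans (.axN4 (.n6 _ _))) (k.1.trans (.axN4 (.n7 _ _))),
      .or_le (h.2.trans (.axN4 (.n6 _ _))) (k.2.trans (.axN4 (.n7 _ _)))⟩
  inf := Quotient.map₂ NForm.and fun _ _ h _ _ k =>
    ⟨.le_and ((N3Proves.and_left _ _).trans h.1) ((N3Proves.and_right _ _).trans k.1),
      .le_and ((N3Proves.and_left _ _).trans h.2) ((N3Proves.and_right _ _).trans k.2)⟩
  himp := Quotient.map₂ NForm.imp fun _ _ h _ _ k => ⟨.imp_mono h.2 k.1, .imp_mono h.1 k.2⟩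
  top := mk T ((NForm.var 0).imp (NForm.var 0))
  le_sup_left := by
    rintro ⟨φ⟩ ⟨ψ⟩
    exact .axN4 (.n6 φ ψ)
  le_sup_right := by
    rintro ⟨φ⟩ ⟨ψ⟩
    exact .axN4 (.n7 φ ψ)
  sup_le := by
    rintro ⟨φ⟩ ⟨ψ⟩ ⟨γ⟩ h k
    exact N3Proves.or_le h k
  inf_le_left := by
    rintro ⟨φ⟩ ⟨ψ⟩
    exact .and_left φ ψ
  inf_le_right := by
    rintro ⟨φ⟩ ⟨ψ⟩
    exact .and_right φ ψ
  le_inf := by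
    rintro ⟨φ⟩ ⟨ψ⟩ ⟨γ⟩ h k
    exact N3Proves.le_and h k
  le_top := by
    rintro ⟨φ⟩
    exact .const φ (.refl _)
  le_himp_iff := by
    rintro ⟨φ⟩ ⟨ψ⟩ ⟨γ⟩
    exact ⟨.uncurry, .curry⟩

theorem mk_and (φ ψ : NForm) : mk T (φ.and ψ) = mk T φ ⊓ mk T ψ := rfl

theorem mk_or (φ ψ : NForm) : mk T (φ.or ψ) = mk T φ ⊔ mk T ψ := rfl

theorem mk_imp (φ ψ : NForm) : mk T (φ.imp ψ) = mk T φ ⇨ mk T ψ := rfl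

theorem mk_eq_top {φ : NForm} : mk T φ = ⊤ ↔ N3Proves T φ := by
  rw [← top_le_iff]
  exact ⟨fun h => .mp (.refl _) h, fun h => .const _ h⟩

theorem mk_eq_of_iff {φ ψ : NForm} (h : N3Proves T (φ.iff ψ)) : mk T φ = mk T ψ :=
  Quotient.sound ⟨.mp h (.and_left _ _), .mp h (.and_right _ _)⟩

theorem mk_neg_neg (φ : NForm) : mk T φ.neg.neg = mk T φ := mk_eq_of_iff (.axN4 (.n9 φ))

theorem mk_neg_or (φ ψ : NForm) : mk T (φ.or ψ).neg = mk T φ.neg ⊓ mk T ψ.neg :=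
  mk_eq_of_iff (.axN4 (.n10 φ ψ))

theorem mk_neg_and (φ ψ : NForm) : mk T (φ.and ψ).neg = mk T φ.neg ⊔ mk T ψ.neg :=
  mk_eq_of_iff (.axN4 (.n11 φ ψ))

theorem mk_neg_imp (φ ψ : NForm) : mk T (φ.imp ψ).neg = mk T φ ⊓ mk T ψ.neg :=
  mk_eq_of_iff (.axN4 (.n12 φ ψ))

theorem disj (φ : NForm) (c : Lindenbaum T) : mk T φ ⊓ mk T φ.neg ≤ c := by
  obtain ⟨ψ⟩ := c
  rw [inf_comm]
  exact N3Proves.uncurry (.ax (.n13 φ ψ))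

theorem mk_neg_le {φ : NForm} (h : N3Proves T φ) (c : Lindenbaum T) : mk T φ.neg ≤ c := by
  simpa [mk_eq_top.2 h] using disj φ c

/-- The twist structure over the Lindenbaum algebra. -/
def twist (T : Set NForm) (α : NForm) : SOps (Twist (Lindenbaum T)) :=
  Twist.ops (mk T (α.imp α).neg) (mk_neg_le (.refl α))

/-- The canonical valuation in the twist structure. -/
def val (T : Set NForm) (n : ℕ) : Twist (Lindenbaum T) :=
  ⟨(mk T (.var n), mk T (NForm.var n).neg), disj _⟩

/-- The negation axioms of `N3` match the second coordinates of the twist operations. For `⇒`, both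
disjuncts of the negated conjunction reduce to the class of `φ ∧ ¬ψ`. -/
theorem eval_toS (α : NForm) (φ : CForm) :
    ((twist T α).eval (val T) φ.toS).1 = (mk T (φ.toN α), mk T (φ.toN α).neg) := by
  have htop : mk T (α.imp α) = ⊤ := mk_eq_top.2 (.refl α)
  induction φ with
  | var n => rfl
  | and φ ψ hφ hψ =>
    change (_ ⊓ _, _ ⊔ _) = _
    rw [hφ, hψ, CForm.toN, mk_and, mk_neg_and]
  | or φ ψ hφ hψ =>
    change (_ ⊔ _, _ ⊓ _) = _
    rw [hφ, hψ, CForm.toN, mk_or, mk_neg_or]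
  | imp φ ψ hφ hψ =>
    change ((_ ⇨ _) ⊓ (_ ⇨ _), _ ⊓ _) = _
    rw [hφ, hψ, CForm.toN, NForm.strong, mk_and, mk_imp, mk_imp, mk_neg_and, mk_neg_imp,
      mk_neg_imp, mk_neg_neg, inf_comm (mk T (ψ.toN α).neg), sup_idem]
  | neg φ hφ =>
    change (_, _) = _
    rw [hφ, CForm.toN, mk_neg_neg]
  | zero =>
    change (_, ⊤) = _
    rw [CForm.toN, mk_neg_neg, htop]
  | one =>
    change (⊤, mk T (α.imp α).neg) = _
    rw [CForm.toN, htop]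

theorem eval_toS_eq_one (α : NForm) (φ : CForm) :
    (twist T α).eval (val T) φ.toS = (twist T α).one ↔ N3Proves T (φ.toN α) := by
  refine ((Twist.isTwist _ (mk_neg_le (.refl α))).eq_one_iff _).trans ?_
  rw [eval_toS, mk_eq_top]

end Lindenbaum

theorem isStrengthening_N3_S (α : NForm) : IsStrengthening (N3Consequence α) SConsequence := by
  intro T φ h
  refine (Lindenbaum.eval_toS_eq_one α φ).1
    (h.eval_eq_one (Twist.isTwist _ _).isPotentResiduated.isSAlgebra _ ?_)
  rintro _ ⟨ψ, hψ, rfl⟩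
  exact (Lindenbaum.eval_toS_eq_one α ψ).2 (.hyp ⟨ψ, hψ, rfl⟩)

/-! ### A non-distributive `S`-algebra -/

/-- The order of the lattice with atoms `1`, `2`, `3` below the coatom `4`, and with bounds
`0` and `5`. -/
def diamondLE (x y : Fin 6) : Bool := x = y || x = 0 || y = 5 || (x ≠ 5 && y = 4)

/-- Meets for `diamondLE`. -/
def diamondInf (x y : Fin 6) : Fin 6 :=
  if diamondLE x y then x else if diamondLE y x then y else 0

/-- Joins for `diamondLE`. -/
def diamondSup (x y : Fin 6) : Fin 6 :=
  if diamondLE x y then y else if diamondLE y x then x else 4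

/-- The product with unit `5` in which all other products are `0`. -/
def diamondMul (x y : Fin 6) : Fin 6 := if x = 5 then y else if y = 5 then x else 0

/-- The residual of `diamondMul`. -/
def diamondImp (x y : Fin 6) : Fin 6 := if diamondLE x y then 5 else if x = 5 then y else 4

/-- The disconnected rotation of the residuated lattice on `Fin 6`: `(true, x)` stands for `x` and
`(false, x)` for `¬x`, all negations lying below all elements of the given lattice. -/
def rotation : SOps (Bool × Fin 6) where
  meet
    | (true, x), (true, y) => (true, diamondInf x y)
    | (false, x), (false, y) => (false, diamondSup x y)
    | (true, _), (false, y) => (false, y)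
    | (false, x), (true, _) => (false, x)
  join
    | (true, x), (true, y) => (true, diamondSup x y)
    | (false, x), (false, y) => (false, diamondInf x y)
    | (true, x), (false, _) => (true, x)
    | (false, _), (true, y) => (true, y)
  imp
    | (true, x), (true, y) => (true, diamondImp x y)
    | (false, x), (false, y) => (true, diamondImp y x)
    | (true, x), (false, y) => (false, diamondMul x y)
    | (false, _), (true, _) => (true, 5)
  neg x := (!x.1, x.2)
  zero := (false, 5)
  one := (true, 5)

/-- The coatom `4` keeps joins of non-units away from the unit `5`, so the product preserves joins.
Non-units of the positive half have square `(true, 0)`, and negative elements have square `(false,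
5)`, the bottom; hence cubes equal squares. The laws are checked over the 12 elements. -/
theorem rotation_isPotentResiduated : rotation.IsPotentResiduated where
  refl := by decide +kernel
  antisymm := by decide +kernel
  trans := by decide +kernel
  meet_left := by decide +kernel
  meet_right := by decide +kernel
  le_meet := by decide +kernel
  join_left := by decide +kernel
  join_right := by decide +kernel
  join_le := by decide +kernel
  zero_le := by decide +kernel
  neg_zero := by decide +kernel
  neg_neg := by decide +kernel
  contrapose := by decide +kernel
  exchange := by decide +kernel
  potent := by decide +kernel

theorem rotation_isSAlgebra : rotation.IsSAlgebra := rotation_isPotentResiduated.isSAlgebra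

theorem rotation_not_isDistributive : ¬ rotation.IsDistributive := fun h =>
  -- The three atoms of the diamond: `1 ∧ (2 ∨ 3) = 1 ∧ 4 = 1`, but `(1 ∧ 2) ∨ (1 ∧ 3) = 0`.
  absurd (h (true, 1) (true, 2) (true, 3)) (by decide)

/-- The distributive law as a formula of the common language. -/
def CForm.distrib : CForm :=
  .imp (.and (.var 1) (.or (.var 2) (.var 3)))
    (.or (.and (.var 1) (.var 2)) (.and (.var 1) (.var 3)))

/-- Generalized Heyting algebras are distributive, which settles the first coordinate; the second
needs the dual law. -/
theorem N3Consequence_distrib (α : NForm) : N3Consequence α ∅ CForm.distrib := by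
  refine (Lindenbaum.eval_toS_eq_one α _).1 (((Twist.isTwist _ _).le_iff _ _).2 ⟨?_, ?_⟩)
  · exact inf_sup_left _ _ _ |>.le
  · exact sup_inf_left _ _ _ |>.ge

theorem not_SConsequence_distrib : ¬ SConsequence ∅ CForm.distrib := by
  intro h
  -- This valuation sends the variables 1, 2, 3 to the three atoms of the diamond.
  have := h.eval_eq_one rotation_isSAlgebra (fun n => (true, Fin.ofNat 6 n)) (by simp)
  revert this
  decide

end Nelson

theorem mainTheorem9 :
    (∀ α : Nelson.NForm,
      Nelson.IsProperStrengthening (Nelson.N3Consequence α) Nelson.SConsequence) ∧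
    (∀ (A : Type u) [Nelson.N3Lattice A] (e : A), (Nelson.N3Lattice.reduct A e).IsSAlgebra) ∧
    (∃ (A : Type) (M : Nelson.SOps A), M.IsSAlgebra ∧ ¬ M.IsDistributive) :=
  ⟨fun α => ⟨Nelson.isStrengthening_N3_S α, ∅, Nelson.CForm.distrib,
      Nelson.N3Consequence_distrib α, Nelson.not_SConsequence_distrib⟩,
    fun A _ e => Nelson.N3Lattice.reduct_isSAlgebra A e,
    _, Nelson.rotation, Nelson.rotation_isSAlgebra, Nelson.rotation_not_isDistributive⟩
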